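/- All rings are commutative with unity. Let $A\subset B$ be an extension of reduced rings. For an intermediate ring $A\subset C\subset B$, call $C$ elementary subintegral over $A$ if $C=A[b]$ for some $b\in C$ with $b^2,b^3\in A$, and subintegral over $A$ if $C$ is a union of subrings each obtained from $A$ by a finite succession of elementary subintegral extensions. Assume that $A$ is subintegrally closed in $B$, i.e. that the largest subintegral extension of $A$ in $B$ is $A$ itself. For a ring extension $R\subset S$ let $\mathcal I(R,S)$ denote the multiplicative group of invertible $R$-submodules of $S$, i.e. of those $R$-submodules $I$ of $S$ for which there is an $R$-submodule $J$ of $S$ with $IJ=R$. Then for all integers $m,n\ge 0$ the homomorphism $$\mathcal I(A,B)\longrightarrow \mathcal I\big(A[X_1,\ldots,X_m],\,B[X_1,\ldots,X_m,Y_1,\ldots,Y_n]\big),\qquad I\longmapsto I\cdot A[X_1,\ldots,X_m],$$ induced by the inclusion $B\subset B[X_1,\ldots,X_m,Y_1,\ldots,Y_n]$ is an isomorphism of groups; in particular $$\mathcal I(A,B)\cong \mathcal I\big(A[X_1,\ldots,X_m],\,B[X_1,\ldots,X_m,Y_1,\ldots,Y_n]\big).$$ -/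

import Mathlib

namespace RingExt

section Subintegral

variable {B : Type*} [CommRing B]

/-- `A ⊆ C` (subrings of `B`) is elementary subintegral: `C = A[b]` with `b ^ 2, b ^ 3 ∈ A`. -/
def IsElementarySubintegral (A C : Subring B) : Prop :=
  ∃ b : B, b ^ 2 ∈ A ∧ b ^ 3 ∈ A ∧ C = (Algebra.adjoin A {b}).toSubring

/-- `C` is obtained from `A` by a finite succession of elementary subintegral extensions. -/
def IsFiniteSubintegral (A C : Subring B) : Prop :=
  Relation.ReflTransGen IsElementarySubintegral A C

/-- `A ⊆ C` (subrings of `B`) is subintegral: `C` is a union of subrings, each obtained from `A`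
by a finite succession of elementary subintegral extensions. -/
def IsSubintegral (A C : Subring B) : Prop :=
  ∃ S : Set (Subring B), (∀ D ∈ S, IsFiniteSubintegral A D) ∧ (C : Set B) = ⋃ D ∈ S, (D : Set B)

/-- The subintegral closure of `A` in `B`. It is the largest subintegral extension of `A` in `B`
by `isGreatest_subintegralClosure` below. -/
def subintegralClosure (A : Subring B) : Subring B :=
  sSup {C | IsSubintegral A C}

/-- `A` is subintegrally closed in `B`: it is equal to its subintegral closure in `B`. -/
def IsSubintegrallyClosed (A : Subring B) : Prop :=
  subintegralClosure A = A

theorem adjoin_toSubring_eq (A : Subring B) (b : B) :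
    (Algebra.adjoin A {b}).toSubring = A ⊔ Subring.closure {b} := by
  apply le_antisymm
  · intro x hx
    replace hx : x ∈ Algebra.adjoin A {b} := hx
    induction hx using Algebra.adjoin_induction with
    | mem x hx => exact (le_sup_right : _ ≤ A ⊔ _) (Subring.subset_closure hx)
    | algebraMap r => exact (le_sup_left : A ≤ A ⊔ _) r.2
    | add x y hx hy h1 h2 => exact add_mem h1 h2
    | mul x y hx hy h1 h2 => exact mul_mem h1 h2
  · refine sup_le ?_ ?_
    · intro x hx
      exact (Algebra.adjoin A {b}).algebraMap_mem ⟨x, hx⟩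
    · rw [Subring.closure_le]
      exact Algebra.subset_adjoin

theorem IsFiniteSubintegral.sup {A D E : Subring B} (hD : IsFiniteSubintegral A D)
    (hE : IsFiniteSubintegral A E) : IsFiniteSubintegral A (D ⊔ E) := by
  induction hE with
  | refl =>
    have h : A ≤ D := by
      induction hD with
      | refl => exact le_rfl
      | tail _ h ih =>
        obtain ⟨b, -, -, rfl⟩ := h
        rw [adjoin_toSubring_eq]
        exact ih.trans le_sup_left
    rwa [sup_eq_left.2 h]
  | @tail E F _ h ih =>
    obtain ⟨b, h2, h3, rfl⟩ := h
    refine Relation.ReflTransGen.tail ih ⟨b, (le_sup_right : E ≤ D ⊔ E) h2,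
      (le_sup_right : E ≤ D ⊔ E) h3, ?_⟩
    rw [adjoin_toSubring_eq, adjoin_toSubring_eq, sup_assoc]

theorem isGreatest_subintegralClosure (A : Subring B) :
    IsGreatest {C | IsSubintegral A C} (subintegralClosure A) := by
  refine ⟨⟨{D | IsFiniteSubintegral A D}, fun D h => h, ?_⟩, fun C hC => le_sSup hC⟩
  have hdir : DirectedOn (· ≤ ·) {D : Subring B | IsFiniteSubintegral A D} :=
    fun D hD E hE => ⟨D ⊔ E, IsFiniteSubintegral.sup hD hE, le_sup_left, le_sup_right⟩
  have hsup : subintegralClosure A = sSup {D : Subring B | IsFiniteSubintegral A D} := by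
    apply le_antisymm
    · refine sSup_le ?_
      rintro C ⟨S, hS, hC⟩ x hx
      have hx' : x ∈ (C : Set B) := hx
      rw [hC] at hx'
      simp only [Set.mem_iUnion] at hx'
      obtain ⟨D, hD, hxD⟩ := hx'
      exact (le_sSup (hS D hD) : D ≤ _) hxD
    · refine sSup_le fun D hD => le_sSup ⟨{D}, ?_, by simp⟩
      rintro _ rfl
      exact hD
  rw [hsup]
  exact Subring.coe_sSup_of_directedOn ⟨A, Relation.ReflTransGen.refl⟩ hdir

end Subintegral

/-- The group `𝓘(A, B)` of invertible `A`-submodules of `B`: the submodules `I` such that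
`I * J = A` for some `A`-submodule `J` of `B`. The group law is multiplication of submodules. -/
abbrev InvSubmodules {B : Type*} [CommRing B] (A : Subring B) : Type _ :=
  (Submodule A B)ˣ

section Functor

variable {B B' : Type*} [CommRing B] [CommRing B']

/-- The `A'`-submodule of `B'` generated by the image of an `A`-submodule of `B`, where
`φ : B → B'` is a ring homomorphism with `φ(A) ⊆ A'`, as a multiplicative map. -/
def extendSubmodule {A : Subring B} {A' : Subring B'} (φ : B →+* B')
    (h : ∀ a ∈ A, φ a ∈ A') : Submodule A B →* Submodule A' B' where
  toFun I := Submodule.span A' (φ '' I)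
  map_one' := by
    apply le_antisymm
    · rw [Submodule.span_le]
      rintro _ ⟨x, hx, rfl⟩
      obtain ⟨a, rfl⟩ := Submodule.mem_one.1 hx
      exact Submodule.mem_one.2 ⟨⟨φ a, h a a.2⟩, rfl⟩
    · rw [Submodule.one_le]
      exact Submodule.subset_span ⟨1, Submodule.one_le.1 le_rfl, map_one φ⟩
  map_mul' I J := by
    apply le_antisymm
    · rw [Submodule.span_le]
      rintro _ ⟨x, hx, rfl⟩
      refine Submodule.mul_induction_on (C := fun x => φ x ∈
        Submodule.span A' (φ '' I) * Submodule.span A' (φ '' J)) hx ?_ ?_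
      · intro m hm n hn
        rw [map_mul]
        exact Submodule.mul_mem_mul (Submodule.subset_span ⟨m, hm, rfl⟩)
          (Submodule.subset_span ⟨n, hn, rfl⟩)
      · intro x y hx hy
        rw [map_add]
        exact add_mem hx hy
    · rw [Submodule.span_mul_span]
      refine Submodule.span_mono ?_
      rintro _ ⟨_, ⟨x, hx, rfl⟩, _, ⟨y, hy, rfl⟩, rfl⟩
      exact ⟨x * y, Submodule.mul_mem_mul hx hy, map_mul φ x y⟩

/-- The group homomorphism `𝓘(φ) : 𝓘(A, B) → 𝓘(A', B')` induced by a morphism `φ` of ring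
extensions, sending `I` to the `A'`-submodule of `B'` generated by `φ(I)`. -/
def InvSubmodules.map {A : Subring B} {A' : Subring B'} (φ : B →+* B')
    (h : ∀ a ∈ A, φ a ∈ A') : InvSubmodules A →* InvSubmodules A' :=
  Units.map (extendSubmodule φ h)

end Functor

section Polynomial

variable {B : Type*} [CommRing B]

/-- The polynomial ring `A[X₁, …, Xₘ]` as a subring of `B[X₁, …, Xₘ, Y₁, …, Yₙ]`. The variables
indexed by `Fin m` are the `Xᵢ`, those indexed by `Fin n` are the `Yⱼ`. -/
noncomputable def polySubring (A : Subring B) (m n : ℕ) : Subring (MvPolynomial (Fin m ⊕ Fin n) B) :=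
  ((MvPolynomial.rename (R := B) (Sum.inl : Fin m → Fin m ⊕ Fin n)).toRingHom.comp
    (MvPolynomial.map A.subtype)).range

theorem C_mem_polySubring (A : Subring B) (m n : ℕ) (a : B) (ha : a ∈ A) :
    (MvPolynomial.C a : MvPolynomial (Fin m ⊕ Fin n) B) ∈ polySubring A m n :=
  ⟨MvPolynomial.C ⟨a, ha⟩, by simp⟩

end Polynomial

end RingExt

namespace RingExt

/-! ### Dedekind–Mertens inequality and Kronecker's integrality theorem -/

section DedekindMertens

/-! Taking constant coefficients induces a retraction of the canonical map, so injectivity is free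
and surjectivity amounts to triviality of the kernel of the retraction. For `y` in that kernel,
write `∑ f i * g i = 1` with `f i ∈ y` and `g i ∈ y⁻¹`. All products `f i * g j` lie in `A[X]` and
all constant coefficients lie in `A`; it suffices to show `f i ∈ A[X]`, the argument for `y⁻¹` being
the same.

The `Y`-variables disappear by a degree count modulo each prime of the reduced ring `B`
(`coeff_eq_zero_of_coeff_mul_eq_zero`).

For the coefficients (`coeff_mem_range_of_sq_cube_closed`), Kronecker's theorem makes them integral
over `A`, so they generate a finite extension `C` of `A`. Subintegral closedness makes the conductor
of `A` in `C` a radical ideal. If it were proper, divide by it and localize at a minimal prime of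
the quotient of `A`: the base becomes a field `k` inside a reduced ring `K`. Since `k[X, Y]` is a
UFD, its Picard group is trivial, and since `K` is reduced, the units of `K[X, Y]` are constants;
hence the coefficients lie in `k`. Clearing denominators gives a nonzero element of the conductor of
the quotient extension, which is absurd. So `C` is the image of `A`. -/

theorem add_pow_succ_le {L : Type*} [IdemCommSemiring L] (a b : L) (n : ℕ) :
    (a + b) ^ (n + 1) ≤ a ^ (n + 1) + b * (a + b) ^ n := by
  induction n with
  | zero => simp
  | succ n ih =>
    calc (a + b) ^ (n + 1 + 1) = a * (a + b) ^ (n + 1) + b * (a + b) ^ (n + 1) := by ring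
      _ ≤ a * (a ^ (n + 1) + b * (a + b) ^ n) + b * (a + b) ^ (n + 1) := by gcongr
      _ = a ^ (n + 1 + 1) + (b * (a * (a + b) ^ n) + b * (a + b) ^ (n + 1)) := by ring
      _ ≤ a ^ (n + 1 + 1) + (b * ((a + b) * (a + b) ^ n) + b * (a + b) ^ (n + 1)) := by
        gcongr
        exact le_self_add
      _ = a ^ (n + 1 + 1) + b * (a + b) ^ (n + 1) := by
        rw [← pow_succ', add_idem]

/-- The combinatorial core of the induction step in the Dedekind–Mertens lemma. -/
theorem dedekindMertens_step {L : Type*} [IdemCommSemiring L] {F G H F' G' H' H'' a b : L} (k : ℕ)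
    (hF' : F' ≤ F) (ha : a ≤ F) (hb : b ≤ G) (hF : F ≤ F' + a) (hG : G ≤ G' + b)
    (hab : a * b ≤ H) (hH' : H' ≤ H + b * F) (hH'' : H'' ≤ H + a * G)
    (h1 : F ^ (k + 1) * G' ≤ F ^ k * H')
    (h2 : F' ^ (k + 2) * G ≤ F' ^ (k + 1) * H'') :
    F ^ (k + 2) * G ≤ F ^ (k + 1) * H := by
  have hFe : F = F' + a := le_antisymm hF (add_le hF' ha)
  -- Splitting `b` off `G` leaves `G'`, to which the induction hypothesis `h1` on the second factor
  -- applies.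
  have e1 : F ^ (k + 1) * G ≤ F ^ k * H + b * F ^ (k + 1) := by
    calc F ^ (k + 1) * G ≤ F ^ (k + 1) * (G' + b) := by gcongr
      _ = F ^ (k + 1) * G' + b * F ^ (k + 1) := by ring
      _ ≤ F ^ k * (H + b * F) + b * F ^ (k + 1) := 
        add_le_add (h1.trans (mul_le_mul_right hH' _)) le_rfl
      _ = F ^ k * H + (b * F ^ (k + 1) + b * F ^ (k + 1)) := by ring
      _ = _ := by rw [add_idem]
  have e2 : a * (F ^ (k + 1) * G) ≤ F ^ (k + 1) * H := by
    calc a * (F ^ (k + 1) * G) ≤ a * (F ^ k * H + b * F ^ (k + 1)) := by gcongr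
      _ = a * (F ^ k * H) + (a * b) * F ^ (k + 1) := by ring
      _ ≤ F * (F ^ k * H) + H * F ^ (k + 1) := by gcongr
      _ = F ^ (k + 1) * H + F ^ (k + 1) * H := by ring
      _ = _ := add_idem _
  -- Every term of `F ^ (k + 2)` except `F' ^ (k + 2)` contains `a`, and `a * b ≤ H`. The remaining
  -- term is bounded by `h2`, whose error term is `e2`.
  have e3 : b * F ^ (k + 2) ≤ F ^ (k + 1) * H := by
    calc b * F ^ (k + 2) ≤ b * (F' ^ (k + 2) + a * F ^ (k + 1)) := by
          gcongr
          have := add_pow_succ_le F' a (k + 1)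
          rwa [← hFe] at this
      _ = b * F' ^ (k + 2) + (a * b) * F ^ (k + 1) := by ring
      _ ≤ G * F' ^ (k + 2) + H * F ^ (k + 1) := by gcongr
      _ = F' ^ (k + 2) * G + F ^ (k + 1) * H := by ring
      _ ≤ F' ^ (k + 1) * (H + a * G) + F ^ (k + 1) * H := 
        add_le_add (h2.trans (mul_le_mul_right hH'' _)) le_rfl
      _ ≤ F ^ (k + 1) * (H + a * G) + F ^ (k + 1) * H := by gcongr
      _ = a * (F ^ (k + 1) * G) + (F ^ (k + 1) * H + F ^ (k + 1) * H) := by ring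
      _ ≤ F ^ (k + 1) * H := by rw [add_idem]; exact add_le e2 le_rfl
  calc F ^ (k + 2) * G = F * (F ^ (k + 1) * G) := by ring
    _ ≤ F * (F ^ k * H + b * F ^ (k + 1)) := by gcongr
    _ = F ^ (k + 1) * H + b * F ^ (k + 2) := by ring
    _ ≤ _ := add_le le_rfl e3

variable {σ B : Type*} (A : Type*) [CommRing A] [CommRing B] [Algebra A B]

open MvPolynomial

/-- The `A`-submodule of `B` spanned by the coefficients of a polynomial over `B`. -/
noncomputable def coeffSpan (f : MvPolynomial σ B) : Submodule A B :=
  Submodule.span A (Set.range fun d => f.coeff d)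

theorem coeff_mem_coeffSpan (f : MvPolynomial σ B) (d : σ →₀ ℕ) : f.coeff d ∈ coeffSpan A f :=
  Submodule.subset_span ⟨d, rfl⟩

variable {A} in
theorem coeffSpan_le {f : MvPolynomial σ B} {M : Submodule A B} :
    coeffSpan A f ≤ M ↔ ∀ d, f.coeff d ∈ M := by
  rw [coeffSpan, Submodule.span_le, Set.range_subset_iff]
  rfl

theorem coeffSpan_fg (f : MvPolynomial σ B) : (coeffSpan A f).FG := by
  refine Submodule.fg_span ((f.support.finite_toSet.image fun d => f.coeff d).insert 0 |>.subset ?_)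
  rintro _ ⟨d, rfl⟩
  by_cases h : f.coeff d = 0
  · exact Or.inl h
  · exact Or.inr ⟨d, mem_support_iff.2 h, rfl⟩

theorem coeffSpan_zero : coeffSpan A (0 : MvPolynomial σ B) = 0 :=
  le_antisymm (coeffSpan_le.2 fun d => by simp) bot_le

theorem coeff_monomial_mul_mem (f : MvPolynomial σ B) (b : B) (e d : σ →₀ ℕ) :
    (monomial e b * f).coeff d ∈ Submodule.span A {b} * coeffSpan A f := by
  classical
  rw [coeff_monomial_mul']
  split_ifs
  · exact Submodule.mul_mem_mul (Submodule.mem_span_singleton_self b) (coeff_mem_coeffSpan A f _)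
  · exact zero_mem _

theorem support_sub_monomial_card_lt {f : MvPolynomial σ B} {d : σ →₀ ℕ} (h : d ∈ f.support) :
    (f - monomial d (f.coeff d)).support.card < f.support.card := by
  classical
  refine Finset.card_lt_card (Finset.ssubset_iff_subset_ne.2 ⟨fun e he => ?_, fun he => ?_⟩)
  · rw [mem_support_iff, coeff_sub, coeff_monomial] at he
    rw [mem_support_iff]
    intro h0
    split_ifs at he with hd
    · subst hd
      simp at he
    · simp [h0] at he
  · rw [← he, mem_support_iff] at h
    simp at h

/-- A weak form of the Dedekind–Mertens lemma for polynomials in several variables. -/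
theorem coeffSpan_pow_mul_le (m : MonomialOrder σ) (N : ℕ) (f g : MvPolynomial σ B)
    (hg : g.support.card ≤ N) :
    coeffSpan A f ^ (N + 1) * coeffSpan A g ≤ coeffSpan A f ^ N * coeffSpan A (f * g) := by
  classical
  induction N generalizing f g with
  -- The exponent is one more than the sharp one, so that the induction can start at `g = 0`.
  | zero =>
    obtain rfl : g = 0 := by simpa using hg
    simp [coeffSpan_zero]
  | succ k ih =>
    induction hn : f.support.card using Nat.strong_induction_on generalizing f with
    | _ n ihf =>
      by_cases hg0 : g = 0
      · subst hg0; simp [coeffSpan_zero]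
      by_cases hf0 : f = 0
      · subst hf0; simp [coeffSpan_zero]
      have hdf := (m.degree_mem_support_iff f).2 hf0
      have hdg := (m.degree_mem_support_iff g).2 hg0
      set a := f.coeff (m.degree f) with ha
      set b := g.coeff (m.degree g) with hb
      set f' := f - monomial (m.degree f) a with hf'
      set g' := g - monomial (m.degree g) b with hg'
      have hle : ∀ {p p' : MvPolynomial σ B} {d : σ →₀ ℕ} (_ : p' = p - monomial d (p.coeff d)),
          coeffSpan A p ≤ coeffSpan A p' + Submodule.span A {p.coeff d} := by
        rintro p p' d rfl
        refine coeffSpan_le.2 fun e => ?_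
        by_cases hd : d = e
        · subst hd
          exact Submodule.mem_sup_right (Submodule.mem_span_singleton_self _)
        · refine Submodule.mem_sup_left ?_
          have := coeff_mem_coeffSpan A (p - monomial d (p.coeff d)) e
          rwa [coeff_sub, coeff_monomial, if_neg hd, sub_zero] at this
      refine dedekindMertens_step (F' := coeffSpan A f') (G' := coeffSpan A g')
        (H' := coeffSpan A (f * g')) (H'' := coeffSpan A (f' * g)) (a := Submodule.span A {a})
        (b := Submodule.span A {b}) k ?_ ?_ ?_ (hle rfl) (hle rfl) ?_ ?_ ?_ ?_ ?_
      · refine coeffSpan_le.2 fun d => ?_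
        rw [hf', coeff_sub, coeff_monomial]
        split_ifs with h
        · rw [ha, h, sub_self]; exact zero_mem _
        · rw [sub_zero]; exact coeff_mem_coeffSpan A f d
      · rw [Submodule.span_singleton_le_iff_mem]; exact coeff_mem_coeffSpan A f _
      · rw [Submodule.span_singleton_le_iff_mem]; exact coeff_mem_coeffSpan A g _
      -- The product of the leading coefficients is itself a coefficient of `f * g`; this is the
      -- reason for using a monomial order.
      · rw [Submodule.span_mul_span, Set.singleton_mul_singleton,
          Submodule.span_singleton_le_iff_mem]
        have := coeff_mem_coeffSpan A (f * g) (m.degree f + m.degree g)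
        rwa [m.coeff_mul_of_degree_add] at this
      · refine coeffSpan_le.2 fun d => ?_
        have : f * g' = f * g - monomial (m.degree g) b * f := by rw [hg']; ring
        rw [this, coeff_sub]
        exact sub_mem (Submodule.mem_sup_left (coeff_mem_coeffSpan A _ d))
          (Submodule.mem_sup_right (coeff_monomial_mul_mem A f b _ d))
      · refine coeffSpan_le.2 fun d => ?_
        have : f' * g = f * g - monomial (m.degree f) a * g := by rw [hf']; ring
        rw [this, coeff_sub]
        exact sub_mem (Submodule.mem_sup_left (coeff_mem_coeffSpan A _ d))
          (Submodule.mem_sup_right (coeff_monomial_mul_mem A g a _ d))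
      · exact ih f g' (Nat.lt_succ_iff.1 ((support_sub_monomial_card_lt hdg).trans_le hg))
      · exact ihf _ (hn ▸ support_sub_monomial_card_lt hdf) f' rfl

variable {A}

/-- Cayley–Hamilton gives a monic `p` with `p(x)` killing `M`. Since `M` need not be faithful, one
only gets `p(x) * y = 0`, hence `p(x) * x ^ n = 0`, and `p * X ^ n` is still monic. -/
theorem isIntegral_of_mul_mem_of_pow_mem {M : Submodule A B} (hM : M.FG) {x : B}
    (hx : ∀ y ∈ M, x * y ∈ M) {y : B} (hy : y ∈ M) {n : ℕ} (hyn : y ∣ x ^ n) : IsIntegral A x := by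
  have : Module.Finite A M := Module.Finite.iff_fg.2 hM
  obtain ⟨p, hp, h⟩ := LinearMap.exists_monic_and_aeval_eq_zero A
    ((LinearMap.mulLeft A x).restrict hx)
  have key : ∀ (q : Polynomial A) (v : M),
      ((Polynomial.aeval ((LinearMap.mulLeft A x).restrict hx) q v : M) : B) =
        Polynomial.aeval x q * v := by
    intro q
    induction q using Polynomial.induction_on with
    | C a => intro v; simp [Algebra.smul_def]
    | add p q hp hq => intro v; simp [hp, hq, add_mul]
    | monomial n a ih =>
      intro v
      have := ih ((LinearMap.mulLeft A x).restrict hx v)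
      simp only [map_mul, map_pow, Polynomial.aeval_X, Polynomial.aeval_C, pow_succ] at this ⊢
      rw [← mul_assoc, Module.End.mul_apply, this]
      rw [mul_assoc, mul_assoc, mul_assoc]
      rfl
  have h0 := key p ⟨y, hy⟩
  rw [h] at h0
  obtain ⟨z, hz⟩ := hyn
  refine ⟨p * Polynomial.X ^ n, hp.mul (Polynomial.monic_X_pow n), ?_⟩
  rw [← Polynomial.aeval_def, map_mul, map_pow, Polynomial.aeval_X, hz, ← mul_assoc]
  simp only [LinearMap.zero_apply, ZeroMemClass.coe_zero] at h0
  rw [← h0, zero_mul]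

/-- **Kronecker's theorem**: if the coefficients of `f * g` come from `A`, then the product of a
coefficient of `f` and a coefficient of `g` is integral over `A`. -/
theorem isIntegral_coeff_mul_coeff [Finite σ] {f g : MvPolynomial σ B}
    (h : ∀ d, (f * g).coeff d ∈ (algebraMap A B).range) (d e : σ →₀ ℕ) :
    IsIntegral A (f.coeff d * g.coeff e) := by
  obtain ⟨n, ⟨i⟩⟩ := Finite.exists_equiv_fin σ
  let _ : LinearOrder σ := LinearOrder.lift' i i.injective
  set N := g.support.card
  have hH : coeffSpan A (f * g) ≤ 1 := coeffSpan_le.2 fun d => by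
    obtain ⟨a, ha⟩ := h d
    exact Submodule.mem_one.2 ⟨a, ha⟩
  have hle : coeffSpan A f ^ (N + 1) * coeffSpan A g ≤ coeffSpan A f ^ N :=
    (coeffSpan_pow_mul_le A MonomialOrder.lex N f g le_rfl).trans
      ((mul_le_mul_right hH _).trans (mul_one _).le)
  -- The witness `y` is the `N`-th power of the coefficient of `f`, which divides the `N`-th power
  -- of the product.
  refine isIntegral_of_mul_mem_of_pow_mem (M := coeffSpan A f ^ N) ((coeffSpan_fg A f).pow N)
    (fun y hy => hle ?_) (Submodule.pow_mem_pow _ (coeff_mem_coeffSpan A f d) N) (n := N) ?_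
  · have : f.coeff d * g.coeff e * y = (y * f.coeff d) * g.coeff e := by ring
    rw [this, pow_succ]
    exact Submodule.mul_mem_mul (Submodule.mul_mem_mul hy (coeff_mem_coeffSpan A f d))
      (coeff_mem_coeffSpan A g e)
  · rw [mul_pow]; exact dvd_mul_right _ _

end DedekindMertens

/-! ### The case of a base field -/

section Field

open MvPolynomial

theorem mem_range_map_iff_coeff_mem {σ R S : Type*} [CommRing R] [CommRing S] (φ : R →+* S)
    (p : MvPolynomial σ S) : p ∈ (MvPolynomial.map φ).range ↔ ∀ d, p.coeff d ∈ φ.range := by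
  constructor
  · rintro ⟨q, rfl⟩ d
    exact ⟨q.coeff d, (MvPolynomial.coeff_map φ q d).symm⟩
  · intro h
    rw [p.as_sum]
    refine sum_mem fun d _ => ?_
    obtain ⟨a, ha⟩ := h d
    exact ⟨monomial d a, by simp [ha]⟩

/-- The `f i` span an invertible `k[σ]`-submodule of `K[σ]`. It is generated by a unit, because the
UFD `k[σ]` has trivial Picard group. That unit is a constant `r`, because `K` is reduced, and `r`
comes from `k`, because every constant coefficient in the module does. -/
theorem coeff_mem_range_of_isField {σ ι k K : Type*} [CommRing k] (hk : IsField k) [CommRing K]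
    [IsReduced K] [Algebra k K] [Fintype ι] {f g : ι → MvPolynomial σ K}
    (h1 : ∑ i, f i * g i = 1)
    (hfg : ∀ i j d, (f i * g j).coeff d ∈ (algebraMap k K).range)
    (h0 : ∀ i, (f i).coeff 0 ∈ (algebraMap k K).range) (i : ι) (d : σ →₀ ℕ) :
    (f i).coeff d ∈ (algebraMap k K).range := by
  classical
  let _ : Field k := hk.toField
  cases subsingleton_or_nontrivial K with
  | inl h => exact ⟨0, Subsingleton.elim _ _⟩
  | inr h =>
  let R := MvPolynomial σ k
  let S := MvPolynomial σ K
  let _ : Algebra R S := (MvPolynomial.map (algebraMap k K)).toAlgebra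
  have hinj : Function.Injective (algebraMap R S) :=
    MvPolynomial.map_injective _ (algebraMap k K).injective
  have : FaithfulSMul R S := (faithfulSMul_iff_algebraMap_injective R S).2 hinj
  let _ : GCDMonoid R := UniqueFactorizationMonoid.toGCDMonoid R
  have hmem : ∀ p : S, p ∈ (1 : Submodule R S) ↔ ∀ d, p.coeff d ∈ (algebraMap k K).range := by
    intro p
    rw [← mem_range_map_iff_coeff_mem, Submodule.mem_one]
    rfl
  set I : Submodule R S := Submodule.span R (Set.range f)
  set J : Submodule R S := Submodule.span R (Set.range g)
  have hIJ : I * J = 1 := by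
    apply le_antisymm
    · rw [Submodule.span_mul_span, Submodule.span_le]
      rintro _ ⟨_, ⟨i, rfl⟩, _, ⟨j, rfl⟩, rfl⟩
      exact (hmem _).2 (hfg i j)
    · rw [Submodule.one_le, ← h1]
      exact sum_mem fun i _ => Submodule.mul_mem_mul (Submodule.subset_span ⟨i, rfl⟩)
        (Submodule.subset_span ⟨i, rfl⟩)
  let U : (Submodule R S)ˣ := Units.mkOfMulEqOne I J hIJ
  have hU : U ∈ (Submodule.unitsToPic R S).ker := Subsingleton.elim _ _
  rw [Submodule.ker_unitsToPic] at hU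
  obtain ⟨u, hu⟩ := hU
  have hI : I = Submodule.span R {(u : S)} := congrArg Units.val hu.symm
  obtain ⟨r, -, hr⟩ := MvPolynomial.isUnit_iff_eq_C_of_isReduced.1 u.isUnit
  have hI0 : ∀ p ∈ I, p.coeff 0 ∈ (algebraMap k K).range := by
    intro p hp
    induction hp using Submodule.span_induction with
    | mem x hx => obtain ⟨i, rfl⟩ := hx; exact h0 i
    | zero => exact zero_mem _
    | add x y _ _ hx hy => exact add_mem hx hy
    | smul a x _ hx =>
      rw [Algebra.smul_def, ← constantCoeff_eq, map_mul]
      refine mul_mem ⟨a.coeff 0, ?_⟩ hx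
      exact (MvPolynomial.coeff_map (algebraMap k K) a 0).symm
  have hr0 : r ∈ (algebraMap k K).range := by
    have := hI0 u (hI ▸ Submodule.mem_span_singleton_self _)
    rwa [hr, coeff_zero_C] at this
  have hi : f i ∈ Submodule.span R {(u : S)} := hI ▸ Submodule.subset_span ⟨i, rfl⟩
  obtain ⟨a, ha⟩ := Submodule.mem_span_singleton.1 hi
  rw [← ha, Algebra.smul_def, hr, mul_comm, coeff_C_mul]
  refine mul_mem hr0 ⟨a.coeff d, ?_⟩
  exact (MvPolynomial.coeff_map (algebraMap k K) a d).symm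

end Field

/-! ### Reduction to a field through the conductor -/

section Conductor

open MvPolynomial

variable {σ ι A B : Type*} [CommRing A] [CommRing B] [Algebra A B]

/-- A reduced ring localized at a minimal prime is a field, so the field case applies to `A_p` and
`B_p`; `s` is a common denominator. -/
theorem exists_notMem_mul_mem_range [IsReduced A] [IsReduced B] [Fintype ι] {p : Ideal A}
    (hp : p ∈ minimalPrimes A) {f g : ι → MvPolynomial σ B} (h1 : ∑ i, f i * g i = 1)
    (hfg : ∀ i j d, (f i * g j).coeff d ∈ (algebraMap A B).range)
    (h0 : ∀ i, (f i).coeff 0 ∈ (algebraMap A B).range) (i : ι) (d : σ →₀ ℕ) :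
    ∃ s ∉ p, algebraMap A B s * (f i).coeff d ∈ (algebraMap A B).range := by
  have hpp : p.IsPrime := hp.1.1
  have : Ring.KrullDimLE 0 (Localization.AtPrime p) := .of_isLocalization p hp _
  have hk : IsField (Localization.AtPrime p) := Ring.KrullDimLE.isField_of_isReduced
  let K := Localization (Algebra.algebraMapSubmonoid B p.primeCompl)
  let φ : B →+* K := algebraMap B K
  have hφ : ∀ b ∈ (algebraMap A B).range, φ b ∈ (algebraMap (Localization.AtPrime p) K).range := by
    rintro _ ⟨a, rfl⟩
    refine ⟨algebraMap A _ a, ?_⟩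
    rw [← IsScalarTower.algebraMap_apply, IsScalarTower.algebraMap_apply A B K]
  have key := coeff_mem_range_of_isField hk (f := fun i => MvPolynomial.map φ (f i))
    (g := fun i => MvPolynomial.map φ (g i)) (by simp_rw [← map_mul, ← map_sum, h1, map_one])
    (fun i j d => by
      rw [← map_mul, MvPolynomial.coeff_map]; exact hφ _ (hfg i j d))
    (fun i => by rw [MvPolynomial.coeff_map]; exact hφ _ (h0 i)) i d
  rw [MvPolynomial.coeff_map] at key
  obtain ⟨x, hx⟩ := key
  obtain ⟨⟨a, s⟩, hs⟩ := IsLocalization.surj p.primeCompl x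
  have h2 : φ (algebraMap A B s * (f i).coeff d) = φ (algebraMap A B a) := by
    have := congrArg (algebraMap (Localization.AtPrime p) K) hs
    rw [map_mul, hx, ← IsScalarTower.algebraMap_apply, ← IsScalarTower.algebraMap_apply,
      IsScalarTower.algebraMap_apply A B K, IsScalarTower.algebraMap_apply A B K] at this
    rw [map_mul, mul_comm]
    exact this
  obtain ⟨⟨_, t, ht, rfl⟩, hc⟩ := (IsLocalization.eq_iff_exists
    (Algebra.algebraMapSubmonoid B p.primeCompl) K).1 h2
  refine ⟨t * s, fun h => (hpp.mem_or_mem h).elim ht s.2, t * a, ?_⟩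
  rw [map_mul, map_mul, mul_assoc]
  exact hc.symm

theorem exists_notMem_forall_mul_mem_range [Module.Finite A B] {p : Ideal A} [p.IsPrime]
    {T : Set B} (hT : Algebra.adjoin A T = ⊤)
    (h : ∀ b ∈ T, ∃ s ∉ p, algebraMap A B s * b ∈ (algebraMap A B).range) :
    ∃ s ∉ p, ∀ b : B, algebraMap A B s * b ∈ (algebraMap A B).range := by
  classical
  have hp : p.IsPrime := inferInstance
  have h' : ∀ b : B, ∃ s ∉ p, algebraMap A B s * b ∈ (algebraMap A B).range := by
    intro b
    have hb : b ∈ Algebra.adjoin A T := hT ▸ Algebra.mem_top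
    induction hb using Algebra.adjoin_induction with
    | mem x hx => exact h x hx
    | algebraMap r => exact ⟨1, p.one_notMem, r, by simp⟩
    | add x y _ _ hx hy =>
      obtain ⟨s, hs, a, ha⟩ := hx
      obtain ⟨t, ht, b, hb⟩ := hy
      refine ⟨s * t, fun h => (hp.mem_or_mem h).elim hs ht, t * a + s * b, ?_⟩
      simp only [map_mul, map_add, ha, hb]
      ring
    | mul x y _ _ hx hy =>
      obtain ⟨s, hs, a, ha⟩ := hx
      obtain ⟨t, ht, b, hb⟩ := hy
      refine ⟨s * t, fun h => (hp.mem_or_mem h).elim hs ht, a * b, ?_⟩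
      simp only [map_mul, ha, hb]
      ring
  obtain ⟨G, hG⟩ := Module.Finite.fg_top (R := A) (M := B)
  choose s hs hsb using h'
  -- Finiteness allows a single denominator: the product over finitely many module generators.
  refine ⟨∏ b ∈ G, s b, fun hmem => ?_, fun b => ?_⟩
  · obtain ⟨b, -, hb⟩ := (Ideal.IsPrime.prod_mem_iff (hp := hp)).1 hmem
    exact hs b hb
  · have hb : b ∈ Submodule.span A (G : Set B) := hG ▸ Submodule.mem_top
    induction hb using Submodule.span_induction with
    | mem x hx =>
      rw [← Finset.prod_erase_mul G s hx, map_mul, mul_assoc]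
      exact mul_mem ⟨_, rfl⟩ (hsb x)
    | zero => rw [mul_zero]; exact zero_mem _
    | add x y _ _ hx hy => rw [mul_add]; exact add_mem hx hy
    | smul a x _ hx =>
      rw [Algebra.smul_def, mul_left_comm]
      exact mul_mem ⟨_, rfl⟩ hx

variable (A B) in
/-- The conductor of `A` in `B`, as an ideal of `B`. -/
def conductorIdeal : Ideal B where
  carrier := {b | ∀ c, b * c ∈ (algebraMap A B).range}
  add_mem' ha hb c := by rw [add_mul]; exact add_mem (ha c) (hb c)
  zero_mem' c := by rw [zero_mul]; exact zero_mem _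
  smul_mem' r b hb c := by rw [smul_eq_mul, mul_comm r, mul_assoc]; exact hb _

theorem mem_range_of_mem_conductorIdeal {b : B} (hb : b ∈ conductorIdeal A B) :
    b ∈ (algebraMap A B).range := by
  simpa using hb 1

/-- If `b ^ 2` is in the conductor, then for each `c` both the square and the cube of `b * c` are
multiples of `b ^ 2`, hence come from `A`. -/
theorem conductorIdeal_isRadical
    (hA : ∀ b : B, b ^ 2 ∈ (algebraMap A B).range → b ^ 3 ∈ (algebraMap A B).range →
      b ∈ (algebraMap A B).range) : (conductorIdeal A B).IsRadical := by
  rw [Ideal.isRadical_iff_pow_one_lt 2 one_lt_two]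
  intro b hb c
  refine hA _ ?_ ?_
  · rw [mul_pow]; exact hb _
  · have : (b * c) ^ 3 = b ^ 2 * (b * c ^ 3) := by ring
    rw [this]; exact hb _

/-- Were the conductor proper, both quotients by it would be reduced. A minimal prime `p` downstairs
then yields some `s ∉ p` in the conductor of the quotient extension, which is zero. -/
theorem algebraMap_surjective_of_finite [Module.Finite A B] [Fintype ι]
    (hA : ∀ b : B, b ^ 2 ∈ (algebraMap A B).range → b ^ 3 ∈ (algebraMap A B).range →
      b ∈ (algebraMap A B).range)
    {f g : ι → MvPolynomial σ B} (h1 : ∑ i, f i * g i = 1)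
    (hfg : ∀ i j d, (f i * g j).coeff d ∈ (algebraMap A B).range)
    (hf0 : ∀ i, (f i).coeff 0 ∈ (algebraMap A B).range)
    (hg0 : ∀ i, (g i).coeff 0 ∈ (algebraMap A B).range)
    (hT : Algebra.adjoin A
      (Set.range (fun x : ι × (σ →₀ ℕ) => (f x.1).coeff x.2) ∪
        Set.range (fun x : ι × (σ →₀ ℕ) => (g x.1).coeff x.2)) = ⊤) :
    Function.Surjective (algebraMap A B) := by
  set c := conductorIdeal A B
  have hc : c.IsRadical := conductorIdeal_isRadical hA
  suffices h : c = ⊤ by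
    intro b
    exact mem_range_of_mem_conductorIdeal (h ▸ Submodule.mem_top : b ∈ c)
  by_contra hne
  let A' := A ⧸ c.comap (algebraMap A B)
  let B' := B ⧸ c
  let π : B →+* B' := Ideal.Quotient.mk c
  have : IsReduced A' := (Ideal.isRadical_iff_quotient_reduced _).1 (hc.comap _)
  have : IsReduced B' := (Ideal.isRadical_iff_quotient_reduced _).1 hc
  have : Nontrivial A' := Ideal.Quotient.nontrivial_iff.2 (Ideal.comap_ne_top _ hne)
  have : Module.Finite A B' := Module.Finite.of_surjective (Ideal.Quotient.mkₐ A c).toLinearMap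
    Ideal.Quotient.mk_surjective
  have : Module.Finite A' B' := Module.Finite.of_restrictScalars_finite A A' B'
  obtain ⟨p, hp⟩ := Ideal.nonempty_minimalPrimes (bot_ne_top (α := Ideal A'))
  have : p.IsPrime := hp.1.1
  have hπ : ∀ b ∈ (algebraMap A B).range, π b ∈ (algebraMap A' B').range := by
    rintro _ ⟨a, rfl⟩
    exact ⟨Ideal.Quotient.mk _ a, rfl⟩
  have h1' : ∑ i, MvPolynomial.map π (f i) * MvPolynomial.map π (g i) = 1 := by
    simp_rw [← map_mul, ← map_sum, h1, map_one]
  have hfg' : ∀ i j d, (MvPolynomial.map π (f i) * MvPolynomial.map π (g j)).coeff d ∈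
      (algebraMap A' B').range := fun i j d => by
    rw [← map_mul, MvPolynomial.coeff_map]; exact hπ _ (hfg i j d)
  have hT' : Algebra.adjoin A' (π '' (Set.range (fun x : ι × (σ →₀ ℕ) => (f x.1).coeff x.2) ∪
        Set.range (fun x : ι × (σ →₀ ℕ) => (g x.1).coeff x.2))) = ⊤ := by
    rw [eq_top_iff]
    rintro x -
    obtain ⟨b, rfl⟩ := Ideal.Quotient.mk_surjective x
    have hb : b ∈ Algebra.adjoin A _ := hT ▸ Algebra.mem_top
    induction hb using Algebra.adjoin_induction with
    | mem x hx => exact Algebra.subset_adjoin ⟨x, hx, rfl⟩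
    | algebraMap r => exact (Algebra.adjoin A' _).algebraMap_mem (Ideal.Quotient.mk _ r)
    | add x y _ _ hx hy => rw [map_add]; exact add_mem hx hy
    | mul x y _ _ hx hy => rw [map_mul]; exact mul_mem hx hy
  obtain ⟨s, hs, hsB⟩ := exists_notMem_forall_mul_mem_range (p := p) hT' (by
    rintro _ ⟨_, ⟨⟨i, d⟩, rfl⟩ | ⟨⟨i, d⟩, rfl⟩, rfl⟩
    · have := exists_notMem_mul_mem_range hp h1' hfg'
        (fun i => by rw [MvPolynomial.coeff_map]; exact hπ _ (hf0 i)) i d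
      rwa [MvPolynomial.coeff_map] at this
    · have := exists_notMem_mul_mem_range hp (f := fun i => MvPolynomial.map π (g i))
        (g := fun i => MvPolynomial.map π (f i)) (by simpa only [mul_comm] using h1')
        (fun i j d => by rw [mul_comm]; exact hfg' j i d)
        (fun i => by rw [MvPolynomial.coeff_map]; exact hπ _ (hg0 i)) i d
      rwa [MvPolynomial.coeff_map] at this)
  obtain ⟨a, rfl⟩ := Ideal.Quotient.mk_surjective s
  refine hs ?_
  -- The conductor lies in the image of `A`, so being in that image can be checked modulo `c`.
  have ha : algebraMap A B a ∈ c := by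
    intro b
    obtain ⟨x, hx⟩ := hsB (π b)
    obtain ⟨a', rfl⟩ := Ideal.Quotient.mk_surjective x
    have hx' : π (algebraMap A B a') = π (algebraMap A B a * b) := hx.trans (map_mul π _ _).symm
    have := mem_range_of_mem_conductorIdeal (Ideal.Quotient.eq.1 hx'.symm)
    have h := add_mem this (⟨a', rfl⟩ : algebraMap A B a' ∈ (algebraMap A B).range)
    rwa [sub_add_cancel] at h
  have : (Ideal.Quotient.mk (c.comap (algebraMap A B)) a) = 0 := Ideal.Quotient.eq_zero_iff_mem.2 ha
  rw [this]
  exact zero_mem _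

/-- If `A` is closed in `B` under adjoining elements with square and cube in `A`, then a rank one
idempotent matrix `f i * g j` over `A[σ]` has `f` and `g` defined over `A`, as soon as the constant
coefficients are. -/
theorem coeff_mem_range_of_sq_cube_closed [Finite σ] [Fintype ι]
    (hA : ∀ b : B, b ^ 2 ∈ (algebraMap A B).range → b ^ 3 ∈ (algebraMap A B).range →
      b ∈ (algebraMap A B).range)
    {f g : ι → MvPolynomial σ B} (h1 : ∑ i, f i * g i = 1)
    (hfg : ∀ i j d, (f i * g j).coeff d ∈ (algebraMap A B).range)
    (hf0 : ∀ i, (f i).coeff 0 ∈ (algebraMap A B).range)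
    (hg0 : ∀ i, (g i).coeff 0 ∈ (algebraMap A B).range) (i : ι) (d : σ →₀ ℕ) :
    (f i).coeff d ∈ (algebraMap A B).range := by
  classical
  set T : Set B := Set.range (fun x : ι × (σ →₀ ℕ) => (f x.1).coeff x.2) ∪
        Set.range (fun x : ι × (σ →₀ ℕ) => (g x.1).coeff x.2)
  have hint : ∀ a ∈ (algebraMap A B).range, IsIntegral A a := by
    rintro _ ⟨a, rfl⟩; exact isIntegral_algebraMap
  have h10 : ∑ i, (f i).coeff 0 * (g i).coeff 0 = 1 := by
    have := congrArg constantCoeff h1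
    simpa only [map_sum, map_mul, map_one, constantCoeff_eq] using this
  have hTint : ∀ b ∈ T, IsIntegral A b := by
    rintro _ (⟨⟨i, d⟩, rfl⟩ | ⟨⟨i, d⟩, rfl⟩)
    -- Kronecker controls only products of coefficients; the relation `h10` among constant
    -- coefficients recovers the single coefficient.
    · have : (f i).coeff d = ∑ j, (f i).coeff d * (g j).coeff 0 * (f j).coeff 0 := by
        calc (f i).coeff d = (f i).coeff d * ∑ j, (f j).coeff 0 * (g j).coeff 0 := by
              rw [h10, mul_one]
          _ = _ := by rw [Finset.mul_sum]; exact Finset.sum_congr rfl fun j _ => by ring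
      dsimp only
      rw [this]
      exact IsIntegral.sum _ fun j _ =>
        (isIntegral_coeff_mul_coeff (hfg i j) d 0).mul (hint _ (hf0 j))
    · have : (g i).coeff d = ∑ j, (f j).coeff 0 * (g i).coeff d * (g j).coeff 0 := by
        calc (g i).coeff d = (g i).coeff d * ∑ j, (f j).coeff 0 * (g j).coeff 0 := by
              rw [h10, mul_one]
          _ = _ := by rw [Finset.mul_sum]; exact Finset.sum_congr rfl fun j _ => by ring
      dsimp only
      rw [this]
      exact IsIntegral.sum _ fun j _ =>
        (isIntegral_coeff_mul_coeff (hfg j i) 0 d).mul (hint _ (hg0 j))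
  have hTfin : T.Finite := by
    refine Set.Finite.subset (s := insert 0 ((⋃ i, ((f i).coeffs : Set B)) ∪
      ⋃ i, ((g i).coeffs : Set B))) ?_ ?_
    · exact ((Set.finite_iUnion fun i => Finset.finite_toSet _).union
        (Set.finite_iUnion fun i => Finset.finite_toSet _)).insert 0
    · rintro _ (⟨⟨i, d⟩, rfl⟩ | ⟨⟨i, d⟩, rfl⟩)
      · by_cases h : (f i).coeff d = 0
        · exact Or.inl h
        · exact Or.inr (Or.inl (Set.mem_iUnion.2 ⟨i, coeff_mem_coeffs d h⟩))
      · by_cases h : (g i).coeff d = 0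
        · exact Or.inl h
        · exact Or.inr (Or.inr (Set.mem_iUnion.2 ⟨i, coeff_mem_coeffs d h⟩))
  let C := Algebra.adjoin A T
  have hfin : Module.Finite A C := Algebra.finite_adjoin_of_finite_of_isIntegral hTfin hTint
  have hC : ∀ b : C, (b : B) ∈ (algebraMap A B).range → b ∈ (algebraMap A C).range := by
    rintro b ⟨a, ha⟩
    exact ⟨a, Subtype.ext ha⟩
  have hlift : ∀ p : MvPolynomial σ B, (∀ d, p.coeff d ∈ T) →
      ∃ q : MvPolynomial σ C, MvPolynomial.map C.val.toRingHom q = p := by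
    intro p hp
    refine (mem_range_map_iff_coeff_mem C.val.toRingHom p).2 fun d => ?_
    exact ⟨⟨_, Algebra.subset_adjoin (hp d)⟩, rfl⟩
  choose f' hf' using fun i => hlift (f i) fun d => Or.inl ⟨(i, d), rfl⟩
  choose g' hg' using fun i => hlift (g i) fun d => Or.inr ⟨(i, d), rfl⟩
  have hinj : Function.Injective (MvPolynomial.map (σ := σ) C.val.toRingHom) :=
    MvPolynomial.map_injective _ Subtype.val_injective
  have hcoe : ∀ (q : MvPolynomial σ C) d,
      ((q.coeff d : C) : B) = (MvPolynomial.map C.val.toRingHom q).coeff d :=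
    fun q d => (MvPolynomial.coeff_map C.val.toRingHom q d).symm
  have hsurj : Function.Surjective (algebraMap A C) := by
    refine algebraMap_surjective_of_finite (f := f') (g := g') ?_ ?_ ?_ ?_ ?_ ?_
    · exact fun b h2 h3 => hC _ (hA _ (by obtain ⟨a, ha⟩ := h2; exact ⟨a, congrArg Subtype.val ha⟩)
        (by obtain ⟨a, ha⟩ := h3; exact ⟨a, congrArg Subtype.val ha⟩))
    · apply hinj
      simp only [map_sum, map_mul, hf', hg', h1, map_one]
    · exact fun i j d => hC _ (by rw [hcoe, map_mul, hf', hg']; exact hfg i j d)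
    · exact fun i => hC _ (by rw [hcoe, hf']; exact hf0 i)
    · exact fun i => hC _ (by rw [hcoe, hg']; exact hg0 i)
    · rw [eq_top_iff, ← Algebra.adjoin_adjoin_coe_preimage (R := A) (s := T)]
      refine Algebra.adjoin_mono ?_
      rintro x (⟨⟨i, d⟩, h⟩ | ⟨⟨i, d⟩, h⟩)
      · refine Or.inl ⟨(i, d), Subtype.ext ?_⟩
        rw [hcoe, hf', ← h]
      · refine Or.inr ⟨(i, d), Subtype.ext ?_⟩
        rw [hcoe, hg', ← h]
  obtain ⟨a, ha⟩ := hsurj ((f' i).coeff d)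
  refine ⟨a, ?_⟩
  have := congrArg Subtype.val ha
  rwa [hcoe, hf'] at this

end Conductor

/-! ### Descent to `A[X]` and the kernel of the retraction -/

section PolynomialExtension

open MvPolynomial

theorem IsSubintegrallyClosed.mem_of_sq_mem_of_cube_mem {B : Type*} [CommRing B] {A : Subring B}
    (hA : IsSubintegrallyClosed A) {b : B} (h2 : b ^ 2 ∈ A) (h3 : b ^ 3 ∈ A) : b ∈ A := by
  have h : (Algebra.adjoin A {b}).toSubring ≤ subintegralClosure A := by
    refine le_sSup ⟨{(Algebra.adjoin A {b}).toSubring}, ?_, by simp⟩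
    rintro _ rfl
    exact Relation.ReflTransGen.single ⟨b, h2, h3, rfl⟩
  rw [hA] at h
  exact h (Algebra.subset_adjoin rfl)

/-- Over a reduced ring, the factors of a rank one idempotent matrix `f i * g j` of polynomials
involve no variable that does not occur in the matrix. -/
theorem coeff_eq_zero_of_coeff_mul_eq_zero {B τ ι : Type*} [CommRing B] [IsReduced B] [Fintype ι]
    {f g : ι → MvPolynomial τ B} (h1 : ∑ i, f i * g i = 1) {s : τ}
    (h : ∀ i j d, d s ≠ 0 → (f i * g j).coeff d = 0) (i : ι) {d : τ →₀ ℕ} (hd : d s ≠ 0) :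
    (f i).coeff d = 0 := by
  -- Modulo a prime the coefficients lie in a domain, where the degree in `s` is additive; some `g
  -- j` survives there because of `h1`.
  refine IsReduced.eq_zero _ (nilpotent_iff_mem_prime.2 fun P hP => ?_)
  rw [← Ideal.Quotient.eq_zero_iff_mem, ← MvPolynomial.coeff_map]
  set π := Ideal.Quotient.mk P
  by_cases hi : MvPolynomial.map π (f i) = 0
  · rw [hi, coeff_zero]
  obtain ⟨j, hj⟩ : ∃ j, MvPolynomial.map π (g j) ≠ 0 := by
    by_contra! hall
    have := congrArg (MvPolynomial.map π) h1
    simp [hall] at this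
  have hdeg : degreeOf s (MvPolynomial.map π (f i) * MvPolynomial.map π (g j)) = 0 := by
    rw [← Nat.le_zero, degreeOf_le_iff]
    intro e he
    by_contra hne
    rw [← map_mul, mem_support_iff, MvPolynomial.coeff_map, h i j e (by omega), map_zero] at he
    exact he rfl
  rw [degreeOf_mul_eq hi hj] at hdeg
  by_contra hne
  have := degreeOf_le_iff.1 (le_refl (degreeOf s (MvPolynomial.map π (f i)))) d
    (mem_support_iff.2 hne)
  omega

theorem exists_fin_sum_of_mem_mul {R S : Type*} [CommSemiring R] [Semiring S] [Algebra R S]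
    {M N : Submodule R S} {x : S} (hx : x ∈ M * N) :
    ∃ (n : ℕ) (f g : Fin n → S), (∀ i, f i ∈ M) ∧ (∀ i, g i ∈ N) ∧ ∑ i, f i * g i = x := by
  induction hx using Submodule.mul_induction_on' with
  | mem_mul_mem a ha b hb => exact ⟨1, fun _ => a, fun _ => b, fun _ => ha, fun _ => hb, by simp⟩
  | add x _ y _ hx hy =>
    obtain ⟨n, f, g, hf, hg, rfl⟩ := hx
    obtain ⟨n', f', g', hf', hg', rfl⟩ := hy
    refine ⟨n + n', Fin.append f f', Fin.append g g', ?_, ?_, ?_⟩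
    · exact fun i => Fin.addCases (by simpa using hf) (by simpa using hf') i
    · exact fun i => Fin.addCases (by simpa using hg) (by simpa using hg') i
    · simp [Fin.sum_univ_add]

variable {B : Type*} [CommRing B] (A : Subring B) (m n : ℕ)

theorem mem_polySubring_iff {p : MvPolynomial (Fin m ⊕ Fin n) B} :
    p ∈ polySubring A m n ↔
      (∀ d, p.coeff d ∈ A) ∧ ∀ j d, d (Sum.inr j) ≠ 0 → p.coeff d = 0 := by
  constructor
  · rintro ⟨q, rfl⟩
    change (∀ d, (rename Sum.inl (MvPolynomial.map A.subtype q)).coeff d ∈ A) ∧ ∀ j d, _ →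
      (rename Sum.inl (MvPolynomial.map A.subtype q)).coeff d = 0
    refine ⟨fun d => ?_, fun j d hd => ?_⟩
    · by_cases h : ∃ u, Finsupp.mapDomain Sum.inl u = d
      · obtain ⟨u, rfl⟩ := h
        rw [coeff_rename_mapDomain _ Sum.inl_injective, MvPolynomial.coeff_map]
        exact (q.coeff u).2
      · rw [coeff_rename_eq_zero _ _ _ fun u hu => (h ⟨u, hu⟩).elim]
        exact zero_mem _
    · refine coeff_rename_eq_zero _ _ _ fun u hu => (hd ?_).elim
      rw [← hu, Finsupp.mapDomain_of_notMem_range]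
      simp
  · rintro ⟨hA, hY⟩
    rw [p.as_sum]
    refine sum_mem fun d hd => ?_
    refine ⟨monomial (d.comapDomain Sum.inl Sum.inl_injective.injOn) ⟨_, hA d⟩, ?_⟩
    change rename Sum.inl (MvPolynomial.map A.subtype _) = _
    rw [MvPolynomial.map_monomial, rename_monomial, Finsupp.mapDomain_comapDomain _
      Sum.inl_injective]
    · rfl
    · intro x hx
      rcases x with x | x
      · exact ⟨x, rfl⟩
      · exact absurd (hY x d (Finsupp.mem_support_iff.1 hx)) (mem_support_iff.1 hd)

theorem constantCoeff_mem_of_mem_polySubring (p : MvPolynomial (Fin m ⊕ Fin n) B)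
    (hp : p ∈ polySubring A m n) : constantCoeff p ∈ A :=
  ((mem_polySubring_iff A m n).1 hp).1 0

theorem extendSubmodule_constantCoeff_extendSubmodule_C (I : Submodule A B) :
    extendSubmodule (constantCoeff : MvPolynomial (Fin m ⊕ Fin n) B →+* B)
      (constantCoeff_mem_of_mem_polySubring A m n)
      (extendSubmodule C (C_mem_polySubring A m n) I) = I := by
  apply le_antisymm
  · refine Submodule.span_le.2 ?_
    rintro _ ⟨p, hp, rfl⟩
    replace hp : p ∈ Submodule.span (polySubring A m n)
      ((C : B →+* MvPolynomial (Fin m ⊕ Fin n) B) '' (I : Set B)) := hp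
    change constantCoeff p ∈ I
    induction hp using Submodule.span_induction with
    | mem x hx => obtain ⟨b, hb, rfl⟩ := hx; simpa using hb
    | zero => rw [map_zero]; exact zero_mem _
    | add x y _ _ hx hy => rw [map_add]; exact add_mem hx hy
    | smul a x _ hx =>
      rw [Subring.smul_def, smul_eq_mul, map_mul]
      exact I.smul_mem ⟨_, constantCoeff_mem_of_mem_polySubring A m n a a.2⟩ hx
  · intro b hb
    exact Submodule.subset_span ⟨C b, Submodule.subset_span ⟨b, hb, rfl⟩, constantCoeff_C _ b⟩

variable {A m n}

theorem mem_polySubring_of_mul_mem [IsReduced B] (hA : IsSubintegrallyClosed A) {ι : Type*}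
    [Fintype ι] {f g : ι → MvPolynomial (Fin m ⊕ Fin n) B} (h1 : ∑ i, f i * g i = 1)
    (hfg : ∀ i j, f i * g j ∈ polySubring A m n) (hf0 : ∀ i, constantCoeff (f i) ∈ A)
    (hg0 : ∀ i, constantCoeff (g i) ∈ A) (i : ι) : f i ∈ polySubring A m n := by
  have hr : ∀ b : B, b ∈ (algebraMap A B).range ↔ b ∈ A := fun b =>
    ⟨by rintro ⟨a, rfl⟩; exact a.2, fun h => ⟨⟨b, h⟩, rfl⟩⟩
  refine (mem_polySubring_iff A m n).2 ⟨fun d => (hr _).1 ?_, fun j d hd => ?_⟩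
  · refine coeff_mem_range_of_sq_cube_closed ?_ h1 ?_ ?_ ?_ i d
    · simp only [hr]
      exact fun b => hA.mem_of_sq_mem_of_cube_mem
    · exact fun i j d => (hr _).2 (((mem_polySubring_iff A m n).1 (hfg i j)).1 d)
    · exact fun i => (hr _).2 (hf0 i)
    · exact fun i => (hr _).2 (hg0 i)
  · exact coeff_eq_zero_of_coeff_mul_eq_zero h1
      (fun i k d hd => ((mem_polySubring_iff A m n).1 (hfg i k)).2 j d hd) i hd

theorem mem_one_iff_mem {S : Type*} [CommRing S] {R : Subring S} {x : S} :
    x ∈ (1 : Submodule R S) ↔ x ∈ R :=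
  Submodule.mem_one.trans ⟨by rintro ⟨a, rfl⟩; exact a.2, fun h => ⟨⟨x, h⟩, rfl⟩⟩

theorem InvSubmodules.mul_mem {S : Type*} [CommRing S] {R : Subring S} (y : InvSubmodules R)
    {p q : S} (hp : p ∈ y.val) (hq : q ∈ y⁻¹.val) : p * q ∈ R := by
  rw [← mem_one_iff_mem, ← y.mul_inv]
  exact Submodule.mul_mem_mul hp hq

theorem InvSubmodules.exists_fin_sum_eq_one {S : Type*} [CommRing S] {R : Subring S}
    (y : InvSubmodules R) : ∃ (n : ℕ) (f g : Fin n → S),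
      (∀ i, f i ∈ y.val) ∧ (∀ i, g i ∈ y⁻¹.val) ∧ ∑ i, f i * g i = 1 := by
  apply exists_fin_sum_of_mem_mul
  rw [y.mul_inv]
  exact Submodule.one_le.1 le_rfl

theorem InvSubmodules.apply_mem_of_map_eq_one {S S' : Type*} [CommRing S] [CommRing S']
    {R : Subring S} {R' : Subring S'} {φ : S →+* S'} {h : ∀ a ∈ R, φ a ∈ R'} {y : InvSubmodules R}
    (hy : InvSubmodules.map φ h y = 1) {p : S} (hp : p ∈ y.val) : φ p ∈ R' := by
  have hle : Submodule.span R' (φ '' (y.val : Set S)) = 1 := congrArg Units.val hy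
  rw [← mem_one_iff_mem, ← hle]
  exact Submodule.subset_span ⟨p, hp, rfl⟩

theorem InvSubmodules.mem_of_map_constantCoeff_eq_one [IsReduced B]
    (hA : IsSubintegrallyClosed A) {y : InvSubmodules (polySubring A m n)}
    (hy : InvSubmodules.map constantCoeff (constantCoeff_mem_of_mem_polySubring A m n) y = 1)
    {p : MvPolynomial (Fin m ⊕ Fin n) B} (hp : p ∈ y.val) : p ∈ polySubring A m n := by
  have hy' : InvSubmodules.map constantCoeff (constantCoeff_mem_of_mem_polySubring A m n) y⁻¹ = 1 :=
    by rw [map_inv, hy, inv_one]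
  obtain ⟨N, f, g, hf, hg, h1⟩ := y.exists_fin_sum_eq_one
  have hfA := mem_polySubring_of_mul_mem hA h1 (fun i j => y.mul_mem (hf i) (hg j))
    (fun i => apply_mem_of_map_eq_one hy (hf i)) (fun i => apply_mem_of_map_eq_one hy' (hg i))
  -- The `f i` generate `y`: each `p * g i` already lies in the base ring.
  have : p = ∑ i, p * g i * f i := by
    calc p = p * ∑ i, f i * g i := by rw [h1, mul_one]
      _ = _ := by rw [Finset.mul_sum]; exact Finset.sum_congr rfl fun i _ => by ring
  rw [this]
  exact sum_mem fun i _ => MulMemClass.mul_mem (y.mul_mem hp (hg i)) (hfA i)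

theorem InvSubmodules.eq_one_of_le {S : Type*} [CommRing S] {R : Subring S} {y : InvSubmodules R}
    (h : ∀ p ∈ y.val, p ∈ R) (h' : ∀ p ∈ y⁻¹.val, p ∈ R) : y = 1 := by
  have hle : ∀ z : InvSubmodules R, (∀ p ∈ z.val, p ∈ R) → z.val ≤ 1 :=
    fun z hz p hp => mem_one_iff_mem.2 (hz p hp)
  refine Units.ext (le_antisymm (hle y h) ?_)
  calc (1 : Submodule R S) = y.val * y⁻¹.val := y.mul_inv.symm
    _ ≤ y.val * 1 := mul_le_mul_right (hle y⁻¹ h') _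
    _ = y.val := mul_one _

theorem InvSubmodules.eq_one_of_map_constantCoeff_eq_one [IsReduced B]
    (hA : IsSubintegrallyClosed A) {y : InvSubmodules (polySubring A m n)}
    (hy : InvSubmodules.map constantCoeff (constantCoeff_mem_of_mem_polySubring A m n) y = 1) :
    y = 1 :=
  eq_one_of_le (fun _ hp => mem_of_map_constantCoeff_eq_one hA hy hp)
    fun _ hp => mem_of_map_constantCoeff_eq_one hA (by rw [map_inv, hy, inv_one]) hp

end PolynomialExtension

end RingExt

/-- The isomorphism is the canonical one: it is induced by the inclusion of `B` in
`B[X₁, …, Xₘ, Y₁, …, Yₙ]`. (`A` is reduced since it is a subring of the reduced ring `B`.) -/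
theorem corollary3p5 {B : Type*} [CommRing B] [IsReduced B] (A : Subring B)
    (hA : RingExt.IsSubintegrallyClosed A) (m n : ℕ) :
    ∃ e : RingExt.InvSubmodules A ≃* RingExt.InvSubmodules (RingExt.polySubring A m n),
      ∀ I : RingExt.InvSubmodules A,
        e I = RingExt.InvSubmodules.map (MvPolynomial.C : B →+* MvPolynomial (Fin m ⊕ Fin n) B)
          (RingExt.C_mem_polySubring A m n) I := by
  set ext := RingExt.InvSubmodules.map (MvPolynomial.C : B →+* MvPolynomial (Fin m ⊕ Fin n) B)
    (RingExt.C_mem_polySubring A m n)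
  set ret := RingExt.InvSubmodules.map
    (MvPolynomial.constantCoeff : MvPolynomial (Fin m ⊕ Fin n) B →+* B)
    (RingExt.constantCoeff_mem_of_mem_polySubring A m n)
  have hret : ∀ I, ret (ext I) = I := fun I =>
    Units.ext (RingExt.extendSubmodule_constantCoeff_extendSubmodule_C A m n I.val)
  refine ⟨MulEquiv.ofBijective ext ⟨Function.LeftInverse.injective hret, fun y => ⟨ret y, ?_⟩⟩,
    fun I => rfl⟩
  -- The quotient of `y` by `ext (ret y)` lies in the kernel of `ret`, which is trivial.
  refine (mul_inv_eq_one.1 (RingExt.InvSubmodules.eq_one_of_map_constantCoeff_eq_one hA ?_)).symm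
  change ret (y * (ext (ret y))⁻¹) = 1
  rw [map_mul, map_inv, hret, mul_inv_cancel]
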